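/- **Support of $\mathrm{Pf}(\Psi_{\mathsf h})$ in single-trace Einstein–Yang–Mills theory.** Let $n\ge 4$. Consider $n$ massless particles in four dimensions, given by complex spinors $|a\rangle,|a]$ ($1\le a\le n$) with momenta $k_a=|a\rangle[a|$ such that $\sum_a k_a=0$ and $s_{ab}=2k_a\cdot k_b=-\langle ab\rangle[ab]\neq0$ for $a\ne b$. Let $|p\rangle,|q]$ be reference spinors with $\langle ap\rangle\ne0$ and $[aq]\neq0$ for all $a$. Each particle has a helicity $\pm$ and polarization vector $$\epsilon_a^\mu(-)=\frac{\langle a|\gamma^\mu|q]}{\sqrt2\,[qa]},\qquad \epsilon_a^\mu(+)=\frac{\langle p|\gamma^\mu|a]}{\sqrt2\,\langle pa\rangle}.$$ A solution of the scattering equations is a tuple $\sigma=(\sigma_1,\dots,\sigma_n)$ of pairwise distinct complex numbers with $\sum_{b\ne a}s_{ab}/\sigma_{ab}=0$ for every $a$, where $\sigma_{ab}=\sigma_a-\sigma_b$. Let $\mathfrak C_-(\sigma)$ be the $n\times n$ matrix with entries $\langle ab\rangle/\sigma_{ab}$ for $a\neq b$ and $-\sum_{c\ne a}\frac{\langle ac\rangle[cq]}{\sigma_{ac}[aq]}$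 for $a=b$. For $0\le m\le n-4$ let $P_-(n-3,m)$ be the set of solutions $\sigma$ with $\operatorname{rank}\mathfrak C_-(\sigma)=m+1$; for all other integers $m$ let $P_-(n-3,m)=\varnothing$. Let $\Psi=\begin{pmatrix}A&-C^T\\ C&B\end{pmatrix}$ be the $2n\times 2n$ matrix with $A_{ab}=s_{ab}/\sigma_{ab}$, $B_{ab}=\epsilon_a\cdot\epsilon_b/\sigma_{ab}$, $C_{ab}=-\sqrt2\,\epsilon_a\cdot k_b/\sigma_{ab}$ for $a\ne b$, and $A_{aa}=B_{aa}=0$, $C_{aa}=\sum_{c\ne a}\sqrt2\,\epsilon_a\cdot k_c/\sigma_{ac}$. Let $s$ of the particles be gravitons, $s^-$ of them of negative and $s^+$ of positive helicity, and let the other $r=n-s$ be gluons, in the colour order $g_1,\dots,g_r$. Let $\Psi_{\mathsf h}$ be the $2s\times2s$ submatrix of $\Psi$ obtained by restricting the row and column indices of the blocks $A$, $B$, $C$ to the gravitons (the sums in $C_{aa}$ still run over all particles). 1. If $\sigma$ is a solution of the scattering equations and $\mathrm{Pf}(\Psi_{\mathsf h}(\sigma))\neq0$, then $$\sigma\in\bigcup_{m=s^--1}^{n-3-s^+}P_-(n-3,m).$$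 2. Let $r\ge2$, and let the configuration be $\mathrm N^k\mathrm{MHV}$, that is, let exactly $k+2$ of the $n$ particles (gluons and gravitons together) have negative helicity, $k\in\mathbb Z$. Put $$\mathcal I_n(\sigma)=\frac{(-\sqrt2)^{n+s}\,\mathrm{Pf}(\Psi_{\mathsf h})\,\mathrm{Pf}'(\Psi)}{\sigma_{g_1g_2}\sigma_{g_2g_3}\cdots\sigma_{g_rg_1}},\qquad \mathcal A_n=\sum_{\sigma}\frac{\mathcal I_n(\sigma)}{\det{}'\Phi(\sigma)},$$ where $\mathrm{Pf}'(\Psi)=-\mathrm{Pf}(\psi)/\sigma_{n-1,n}$ with $\psi$ obtained from $\Psi$ by deleting its rows and columns number $n-1$ and $n$; where $\Phi_{ab}=s_{ab}/\sigma_{ab}^2$ for $a\neq b$, $\Phi_{aa}=-\sum_{c\ne a}s_{ac}/\sigma_{ac}^2$, and $\det'\Phi$ is the determinant of $\Phi$ without its last three rows and columns, divided by $(\sigma_{n-2,n-1}\sigma_{n-1,n}\sigma_{n,n-2})^2$; and where the sum runs over the solutions up to Möbius transformations. If $\mathcal A_n\ne0$, or if $\mathcal I_n(\sigma)\neq0$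 for at least one solution $\sigma$, then $$\max\{0,\,s^--1\}\le k\le\min\{n-4,\,n-3-s^+\}.$$ -/

import Mathlib

open scoped BigOperators Nat

noncomputable section

namespace CHY

/-- A two-component complex Weyl spinor. -/
abbrev Spinor := Fin 2 → ℂ

/-- The angle bracket of two spinors. -/
def ang (x y : Spinor) : ℂ := x 0 * y 1 - x 1 * y 0

/-- The square bracket of two conjugate spinors, with the sign convention in which
`2 k_a ⬝ k_b = ⟨ab⟩[ba] = -⟨ab⟩[ab]`. -/
def sqb (x y : Spinor) : ℂ := x 1 * y 0 - x 0 * y 1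

/-- Complexified four-vectors in bispinor form: the vector `½⟨x|γ^μ|y]` is represented by
the matrix `x yᵀ`. -/
abbrev FourVec := Matrix (Fin 2) (Fin 2) ℂ

/-- The Minkowski product of four-vectors in bispinor form, the polarization of `det`
(so that `v ⬝ v = det v`). On `x yᵀ` and `z wᵀ` it is `½⟨xz⟩[wy]`. -/
def dot (v w : FourVec) : ℂ :=
  (v 0 0 * w 1 1 + v 1 1 * w 0 0 - v 0 1 * w 1 0 - v 1 0 * w 0 1) / 2

/-- External data of `n` massless particles in four dimensions: the spinors `|a⟩` and `|a]`,
the reference spinors `|p⟩` and `|q]`, and the set `neg` of negative-helicity particles (all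
others have positive helicity). -/
structure External (n : ℕ) where
  lam : Fin n → Spinor
  lamt : Fin n → Spinor
  p : Spinor
  q : Spinor
  neg : Finset (Fin n)

variable {n : ℕ}

namespace External

/-- The momentum `k_a = |a⟩[a|`. -/
def mom (E : External n) (a : Fin n) : FourVec := Matrix.vecMulVec (E.lam a) (E.lamt a)

/-- The Mandelstam variable `s_ab = 2 k_a ⬝ k_b`. -/
def mandelstam (E : External n) (a b : Fin n) : ℂ := 2 * dot (E.mom a) (E.mom b)

/-- The polarization vectors `ε_a(-) = ⟨a|γ|q] / (√2 [qa])` and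
`ε_a(+) = ⟨p|γ|a] / (√2 ⟨pa⟩)`. -/
def pol (E : External n) (a : Fin n) : FourVec :=
  if a ∈ E.neg then
    (2 / ((Real.sqrt 2 : ℂ) * sqb E.q (E.lamt a))) • Matrix.vecMulVec (E.lam a) E.q
  else
    (2 / ((Real.sqrt 2 : ℂ) * ang E.p (E.lam a))) • Matrix.vecMulVec E.p (E.lamt a)

/-- The standing assumptions: momentum conservation, no vanishing Mandelstam variable, and
reference spinors that do not coincide with any external spinor. -/
structure Admissible (E : External n) : Prop where
  conservation : ∑ a, E.mom a = 0
  mandelstam_ne_zero : ∀ a b, a ≠ b → E.mandelstam a b ≠ 0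
  ang_ne_zero : ∀ a, ang (E.lam a) E.p ≠ 0
  sqb_ne_zero : ∀ a, sqb (E.lamt a) E.q ≠ 0

/-- The solutions of the scattering equations: pairwise distinct punctures `σ_a` with
`∑_{b ≠ a} s_ab / (σ_a - σ_b) = 0` for all `a`. -/
def solutions (E : External n) : Set (Fin n → ℂ) :=
  {σ | Function.Injective σ ∧
    ∀ a, ∑ b ∈ Finset.univ.erase a, E.mandelstam a b / (σ a - σ b) = 0}

/-- The discriminant matrix `ℭ₋`. -/
def discMinus (E : External n) (σ : Fin n → ℂ) : Matrix (Fin n) (Fin n) ℂ :=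
  Matrix.of fun a b =>
    if a = b then
      -∑ c ∈ Finset.univ.erase a,
        ang (E.lam a) (E.lam c) * sqb (E.lamt c) E.q /
          ((σ a - σ c) * sqb (E.lamt a) E.q)
    else ang (E.lam a) (E.lam b) / (σ a - σ b)

/-- The class `P₋(n-3, m)` of solutions with `rank ℭ₋ = m + 1`, for `0 ≤ m ≤ n - 4`; it is
empty for all other integers `m`. -/
def PMinus (E : External n) (m : ℤ) : Set (Fin n → ℂ) :=
  {σ | σ ∈ E.solutions ∧ 0 ≤ m ∧ m ≤ (n : ℤ) - 4 ∧ ((E.discMinus σ).rank : ℤ) = m + 1}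

/-- The block `A`, with entries `s_ab / σ_ab` and zero diagonal. -/
def matA (E : External n) (σ : Fin n → ℂ) : Matrix (Fin n) (Fin n) ℂ :=
  Matrix.of fun a b => if a = b then 0 else E.mandelstam a b / (σ a - σ b)

/-- The block `B`, with entries `ε_a ⬝ ε_b / σ_ab` and zero diagonal. -/
def matB (E : External n) (σ : Fin n → ℂ) : Matrix (Fin n) (Fin n) ℂ :=
  Matrix.of fun a b => if a = b then 0 else dot (E.pol a) (E.pol b) / (σ a - σ b)

/-- The block `C`, with entries `-√2 ε_a ⬝ k_b / σ_ab` off the diagonal and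
`∑_{c ≠ a} √2 ε_a ⬝ k_c / σ_ac` on it; the sum is over all particles. -/
def matC (E : External n) (σ : Fin n → ℂ) : Matrix (Fin n) (Fin n) ℂ :=
  Matrix.of fun a b =>
    if a = b then
      ∑ c ∈ Finset.univ.erase a,
        (Real.sqrt 2 : ℂ) * dot (E.pol a) (E.mom c) / (σ a - σ c)
    else -((Real.sqrt 2 : ℂ) * dot (E.pol a) (E.mom b) / (σ a - σ b))

/-- The matrix `Ψ = (A, -Cᵀ; C, B)`. -/
def matPsi (E : External n) (σ : Fin n → ℂ) : Matrix (Fin n ⊕ Fin n) (Fin n ⊕ Fin n) ℂ :=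
  Matrix.fromBlocks (E.matA σ) (-(E.matC σ).transpose) (E.matC σ) (E.matB σ)

end External

/-- The Pfaffian of an antisymmetric `N × N` matrix,
`1 / (2^{N/2} (N/2)!) ∑_π sgn(π) ∏_i M_{π(2i), π(2i+1)}` for even `N` and zero for odd `N`. -/
def pfaffian {N : ℕ} (M : Matrix (Fin N) (Fin N) ℂ) : ℂ :=
  if Even N then
    ((2 : ℂ) ^ (N / 2) * ((N / 2)! : ℂ))⁻¹ *
      ∑ π : Equiv.Perm (Fin N), ((Equiv.Perm.sign π : ℤ) : ℂ) *
        ∏ i : Fin (N / 2), M (π ⟨2 * i, by omega⟩) (π ⟨2 * i + 1, by omega⟩)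
  else 0

/-- The Pfaffian of a matrix in two blocks, the rows of the first block coming first. -/
def pfaffianSum {N₁ N₂ : ℕ} (M : Matrix (Fin N₁ ⊕ Fin N₂) (Fin N₁ ⊕ Fin N₂) ℂ) : ℂ :=
  pfaffian (Matrix.reindex finSumFinEquiv finSumFinEquiv M)

namespace External

/-- The reduced Pfaffian `Pf' Ψ = -Pf(ψ) / σ_{n-1,n}`, where `ψ` is `Ψ` without its
rows and columns number `n-1` and `n`. -/
def reducedPf (hn : 4 ≤ n) (E : External n) (σ : Fin n → ℂ) : ℂ :=
  -1 / (σ ⟨n - 2, by omega⟩ - σ ⟨n - 1, by omega⟩) *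
    pfaffianSum ((E.matPsi σ).submatrix
      (Sum.map (Fin.castLE (Nat.sub_le n 2)) id) (Sum.map (Fin.castLE (Nat.sub_le n 2)) id))

/-- The Jacobian matrix `Φ` of the scattering equations. -/
def matPhi (E : External n) (σ : Fin n → ℂ) : Matrix (Fin n) (Fin n) ℂ :=
  Matrix.of fun a b =>
    if a = b then -∑ c ∈ Finset.univ.erase a, E.mandelstam a c / (σ a - σ c) ^ 2
    else E.mandelstam a b / (σ a - σ b) ^ 2

/-- The reduced determinant `det' Φ`: the determinant of `Φ` without its last three rows and
columns, over `(σ_{n-2,n-1} σ_{n-1,n} σ_{n,n-2})²`. -/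
def reducedDet (hn : 4 ≤ n) (E : External n) (σ : Fin n → ℂ) : ℂ :=
  ((E.matPhi σ).submatrix (Fin.castLE (Nat.sub_le n 3)) (Fin.castLE (Nat.sub_le n 3))).det /
    ((σ ⟨n - 3, by omega⟩ - σ ⟨n - 2, by omega⟩) *
      (σ ⟨n - 2, by omega⟩ - σ ⟨n - 1, by omega⟩) *
      (σ ⟨n - 1, by omega⟩ - σ ⟨n - 3, by omega⟩)) ^ 2

/-- Solutions that differ by a Möbius transformation of the Riemann sphere are identified. -/
def moebius (E : External n) : Setoid E.solutions where
  r σ τ := ∃ g : GL (Fin 2) ℂ, ∀ a, g • (σ.1 a : OnePoint ℂ) = (τ.1 a : OnePoint ℂ)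
  iseqv :=
    { refl := fun _ => ⟨1, fun _ => one_smul _ _⟩
      symm := by
        rintro σ τ ⟨g, hg⟩
        exact ⟨g⁻¹, fun a => by rw [← hg a, inv_smul_smul]⟩
      trans := by
        rintro σ τ ρ ⟨g, hg⟩ ⟨g₂, hg₂⟩
        exact ⟨g₂ * g, fun a => by rw [mul_smul, hg a, hg₂ a]⟩ }

end External

/-- The `n` particles of a single-trace amplitude: `s` gravitons `h_1, …, h_s` and `r` gluons
`g_1, …, g_r`, the latter in their colour order. -/
abbrev Labelling (s r n : ℕ) := Fin s ⊕ Fin r ≃ Fin n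

namespace Labelling

variable {s r : ℕ}

/-- The graviton labels. -/
def graviton (L : Labelling s r n) (i : Fin s) : Fin n := L (Sum.inl i)

/-- The gluon labels. -/
def gluon (L : Labelling s r n) (j : Fin r) : Fin n := L (Sum.inr j)

/-- The number `s⁻` of negative-helicity gravitons. -/
def sMinus (L : Labelling s r n) (E : External n) : ℕ :=
  (Finset.univ.filter fun i => L.graviton i ∈ E.neg).card

/-- The number `s⁺` of positive-helicity gravitons. -/
def sPlus (L : Labelling s r n) (E : External n) : ℕ :=
  (Finset.univ.filter fun i => L.graviton i ∉ E.neg).card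

/-- The `2s × 2s` matrix `Ψ_h`: the blocks of `Ψ` restricted to the gravitons. -/
def matPsiH (L : Labelling s r n) (E : External n) (σ : Fin n → ℂ) :
    Matrix (Fin s ⊕ Fin s) (Fin s ⊕ Fin s) ℂ :=
  (E.matPsi σ).submatrix (Sum.map L.graviton L.graviton) (Sum.map L.graviton L.graviton)

/-- `Pf(Ψ_h)`. -/
def pfH (L : Labelling s r n) (E : External n) (σ : Fin n → ℂ) : ℂ :=
  pfaffianSum (L.matPsiH E σ)

/-- The integrand of single-trace Einstein-Yang-Mills theory,
`(-√2)^{n+s} Pf(Ψ_h) Pf'(Ψ) / (σ_{g_1 g_2} σ_{g_2 g_3} ⋯ σ_{g_r g_1})`. -/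
def integrand (hn : 4 ≤ n) (L : Labelling s r n) (E : External n) (σ : Fin n → ℂ) : ℂ :=
  (-(Real.sqrt 2 : ℂ)) ^ (n + s) * L.pfH E σ * E.reducedPf hn σ /
    ∏ j : Fin r, (σ (L.gluon j) - σ (L.gluon (finRotate r j)))

/-- The tree-level single-trace amplitude: the sum of the integrand over `det' Φ`, one term for
each solution up to Möbius transformations (the summand is Möbius invariant). -/
def amplitude (hn : 4 ≤ n) (L : Labelling s r n) (E : External n) : ℂ :=
  ∑ᶠ c : Quotient E.moebius, L.integrand hn E c.out.1 / E.reducedDet hn c.out.1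

end Labelling

end CHY

end

/-! On a solution the vector ∑ k_c / (z - σ_c) is null for every z, so clearing denominators gives a
2 × 2 matrix of polynomials with zero determinant. It factors as l_i m_j with coprime l, of degrees
d and e. Momentum conservation removes the top coefficient, hence d + e ≤ n - 2 (`exists_isCurve`).
Up to scale, |a⟩ and |a] are the values at σ_a of l and m. The degree d is the rank of ℭ₋, whose
kernel is parametrized by polynomials of degree < n - d (`rank_discMinus`).

The helicity bounds come from null vectors of minors of Ψ. Pairs of polynomials of degree < s - d
give spinors ξ_b, and |b⟩ξ_b expands in k_b and ε_b(-). The resulting vectors are killed by all rows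
except those of ε_a(+), once the ε-coefficients at positive helicity vanish. This costs two
conditions per positive particle, and one more per deleted index of `A`. If 2(s - d) exceeds their
number, the Pfaffian vanishes. Hence Pf(Ψ_h) ≠ 0 gives s⁻ ≤ d, and by parity s⁺ ≤ e. The same count
for Pf' Ψ, with two deleted indices, forces d = k + 1 and e = n - 3 - k. -/

/-! ### Partial fractions -/

open Polynomial in
-- Write G = (X - σ_a) H. Then G'(σ_a) = H(σ_a), and the sum is the Lagrange interpolation of H
-- through the other nodes, evaluated at σ_a; the bound on G puts H within its range.
theorem Polynomial.sum_eval_div_eq_derivative_eval {ι : Type*} [Fintype ι] [DecidableEq ι]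
    {σ : ι → ℂ} (hσ : Function.Injective σ) {G : ℂ[X]} (hG : G.degree < Fintype.card ι) {a : ι}
    (h0 : G.eval (σ a) = 0) :
    ∑ b ∈ Finset.univ.erase a,
        G.eval (σ b) / (∏ c ∈ Finset.univ.erase b, (σ b - σ c)) / (σ a - σ b) =
      G.derivative.eval (σ a) / ∏ c ∈ Finset.univ.erase a, (σ a - σ c) := by
  obtain ⟨H, rfl⟩ := dvd_iff_isRoot.2 h0
  have hcard : (Finset.univ.erase a).card + 1 = Fintype.card ι :=
    Finset.card_erase_add_one (Finset.mem_univ a)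
  have hH : H.degree < (Finset.univ.erase a).card := by
    by_cases hH0 : H = 0
    · simp [hH0, bot_lt_iff_ne_bot]
    · rw [degree_mul, degree_X_sub_C, degree_eq_natDegree hH0, ← hcard] at hG
      rw [degree_eq_natDegree hH0]
      have : 1 + H.natDegree < (Finset.univ.erase a).card + 1 := by exact_mod_cast hG
      exact_mod_cast (by omega : H.natDegree < (Finset.univ.erase a).card)
  have hne : ∀ {b c : ι}, b ≠ c → σ b - σ c ≠ 0 := fun h => sub_ne_zero.2 (hσ.ne h)
  have hx : ∀ i ∈ Finset.univ.erase a, σ a ≠ σ i := fun i hi => hσ.ne (Finset.ne_of_mem_erase hi).symm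
  have key := congrArg (eval (σ a))
    (Lagrange.eq_interpolate (s := Finset.univ.erase a) (v := σ) hσ.injOn hH)
  rw [Lagrange.eval_interpolate_not_at_node _ hx, Lagrange.eval_nodal] at key
  have hD : ∏ c ∈ Finset.univ.erase a, (σ a - σ c) ≠ 0 :=
    Finset.prod_ne_zero_iff.2 fun c hc => hne (Finset.ne_of_mem_erase hc).symm
  simp only [derivative_mul, derivative_sub, derivative_X, derivative_C, sub_zero, one_mul,
    eval_add, eval_mul, eval_sub, eval_X, eval_C, sub_self, zero_mul, add_zero]
  rw [eq_div_iff hD, key, mul_comm]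
  congr 1
  refine Finset.sum_congr rfl fun b hb => ?_
  have hba : b ≠ a := Finset.ne_of_mem_erase hb
  have : ∏ c ∈ Finset.univ.erase b, (σ b - σ c) =
      (σ b - σ a) * ∏ c ∈ (Finset.univ.erase a).erase b, (σ b - σ c) := by
    rw [Finset.erase_right_comm]
    exact (Finset.mul_prod_erase _ _ (Finset.mem_erase.2 ⟨hba.symm, Finset.mem_univ a⟩)).symm
  rw [this, Lagrange.nodalWeight, Finset.prod_inv_distrib]
  have h1 := hne hba
  have h2 := hne hba.symm
  have h3 : ∏ c ∈ (Finset.univ.erase a).erase b, (σ b - σ c) ≠ 0 :=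
    Finset.prod_ne_zero_iff.2 fun c hc => hne (Finset.ne_of_mem_erase hc).symm
  field_simp

/-! ### Vanishing of Pfaffians -/

namespace CHY

/-- A matrix killed from both sides by the same nonzero vector has vanishing Pfaffian. -/
theorem pfaffian_eq_zero {N : ℕ} {M : Matrix (Fin N) (Fin N) ℂ} {v : Fin N → ℂ} (hv : v ≠ 0)
    (hr : ∀ a, ∑ b, M a b * v b = 0) (hl : ∀ b, ∑ a, v a * M a b = 0) : pfaffian M = 0 := by
  unfold pfaffian
  split_ifs with hN
  swap
  · rfl
  obtain ⟨i, hi⟩ := Function.ne_iff.1 hv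
  let F : (Fin N → Fin N) → ℂ := fun f =>
    ∏ j : Fin (N / 2), M (f ⟨2 * j, by omega⟩) (f ⟨2 * j + 1, by omega⟩)
  -- Up to normalization, the Pfaffian after index i is replaced by k in rows and columns. For k ≠ i
  -- two indices coincide, so π and its composite with the swap of i and k cancel.
  let S : Fin N → ℂ := fun k => ∑ π : Equiv.Perm (Fin N), ((Equiv.Perm.sign π : ℤ) : ℂ) *
    F fun x => Function.update id i k (π x)
  have hS : ∀ k, k ≠ i → S k = 0 := by
    intro k hk
    have : S k = -S k := by
      conv_lhs => rw [show S k = _ from (Equiv.sum_comp (Equiv.mulLeft (Equiv.swap i k)) _).symm]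
      rw [show S k = ∑ π : Equiv.Perm (Fin N), ((Equiv.Perm.sign π : ℤ) : ℂ) *
        F fun x => Function.update id i k (π x) from rfl, ← Finset.sum_neg_distrib]
      refine Finset.sum_congr rfl fun π _ => ?_
      have : ∀ y, Function.update id i k (Equiv.swap i k y) = Function.update id i k y := by
        intro y
        rcases eq_or_ne y i with rfl | hy
        · simp [Function.update_of_ne hk]
        rcases eq_or_ne y k with rfl | hy'
        · simp [Function.update_of_ne hk]
        · rw [Equiv.swap_apply_of_ne_of_ne hy hy']
      simp [this, Equiv.Perm.sign_swap hk.symm]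
    linear_combination this / 2
  have hsum : ∑ k, v k * S k = 0 := by
    simp only [S, Finset.mul_sum]
    rw [Finset.sum_comm]
    refine Finset.sum_eq_zero fun π _ => ?_
    -- Exactly one factor of the product contains i, as its left or its right index; summing that
    -- factor against v gives zero by `hl` or `hr`.
    have hF : ∑ k, v k * F (fun x => Function.update id i k (π x)) = 0 := by
      obtain ⟨j, hj⟩ : ∃ j : Fin (N / 2),
          π ⟨2 * j, by omega⟩ = i ∨ π ⟨2 * j + 1, by omega⟩ = i := by
        have h2 := Nat.two_mul_div_two_of_even hN
        have h3 := (π.symm i).2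
        refine ⟨⟨(π.symm i : ℕ) / 2, by omega⟩, ?_⟩
        rcases Nat.even_or_odd' (π.symm i : ℕ) with ⟨c, hc | hc⟩
        · left
          rw [← Equiv.eq_symm_apply]
          ext
          simp only
          omega
        · right
          rw [← Equiv.eq_symm_apply]
          ext
          simp only
          omega
      have hoff : ∀ k x, π x ≠ i → Function.update id i k (π x) = π x := fun k x hx => by
        simp [Function.update_of_ne hx]
      have hrest : ∀ k, F (fun x => Function.update id i k (π x)) =
          M (Function.update id i k (π ⟨2 * j, by omega⟩))
            (Function.update id i k (π ⟨2 * j + 1, by omega⟩)) *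
          ∏ l ∈ Finset.univ.erase j, M (π ⟨2 * l, by omega⟩) (π ⟨2 * l + 1, by omega⟩) := by
        intro k
        simp only [F]
        rw [← Finset.mul_prod_erase _ _ (Finset.mem_univ j)]
        congr 1
        refine Finset.prod_congr rfl fun l hl => ?_
        have hlj : (l : ℕ) ≠ j := fun h => Finset.ne_of_mem_erase hl (Fin.ext h)
        have hne : ∀ x : Fin N, (x : ℕ) ≠ 2 * j → (x : ℕ) ≠ 2 * j + 1 → π x ≠ i := by
          intro x h1 h2 hx
          rcases hj with hj | hj
          · exact h1 (congrArg Fin.val (π.injective (hx.trans hj.symm)))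
          · exact h2 (congrArg Fin.val (π.injective (hx.trans hj.symm)))
        rw [hoff k _ (hne _ (by simp only; omega) (by simp only; omega)),
          hoff k _ (hne _ (by simp only; omega) (by simp only; omega))]
      simp only [hrest, ← mul_assoc]
      rw [← Finset.sum_mul]
      refine mul_eq_zero_of_left ?_ _
      rcases hj with hj | hj
      · have : π ⟨2 * j + 1, by omega⟩ ≠ i := by
          rw [← hj, π.injective.ne_iff]
          simp [Fin.ext_iff]
        simp only [hoff _ _ this, hj, Function.update_self]
        exact hl _
      · have : π ⟨2 * j, by omega⟩ ≠ i := by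
          rw [← hj, π.injective.ne_iff]
          simp [Fin.ext_iff]
        simp only [hoff _ _ this, hj, Function.update_self, mul_comm (v _)]
        exact hr _
    calc ∑ k, v k * (((Equiv.Perm.sign π : ℤ) : ℂ) * F fun x => Function.update id i k (π x))
        = ((Equiv.Perm.sign π : ℤ) : ℂ) * ∑ k, v k * F fun x => Function.update id i k (π x) := by
          rw [Finset.mul_sum]
          exact Finset.sum_congr rfl fun k _ => by ring
      _ = 0 := by rw [hF, mul_zero]
  rw [Finset.sum_eq_single i (fun k _ hk => by rw [hS k hk, mul_zero]) (by simp)] at hsum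
  have hSi : S i = 0 := (mul_eq_zero.1 hsum).resolve_left hi
  refine mul_eq_zero_of_right _ ?_
  have hid : Function.update id i i = (id : Fin N → Fin N) := Function.update_eq_self i id
  simpa [S, F, hid] using hSi

theorem pfaffianSum_eq_zero {N₁ N₂ : ℕ} {M : Matrix (Fin N₁ ⊕ Fin N₂) (Fin N₁ ⊕ Fin N₂) ℂ}
    (hM : ∀ a b, M b a = -M a b) {v : Fin N₁ ⊕ Fin N₂ → ℂ} (hv : v ≠ 0)
    (h : M.mulVec v = 0) : pfaffianSum M = 0 := by
  have h' : ∀ a, ∑ b, M a b * v b = 0 := fun a => congrFun h a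
  refine pfaffian_eq_zero (v := v ∘ finSumFinEquiv.symm) ?_ (fun a => ?_) (fun b => ?_)
  · intro h0
    exact hv (by simpa [Function.comp_assoc] using congrArg (· ∘ finSumFinEquiv) h0)
  · rw [← h' (finSumFinEquiv.symm a), ← Equiv.sum_comp finSumFinEquiv.symm]
    rfl
  · rw [← neg_eq_zero, ← h' (finSumFinEquiv.symm b), ← Equiv.sum_comp finSumFinEquiv.symm,
      ← Finset.sum_neg_distrib]
    refine Finset.sum_congr rfl fun a _ => ?_
    simp only [Matrix.reindex_apply, Matrix.submatrix_apply, Function.comp_apply]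
    rw [hM (finSumFinEquiv.symm b)]
    ring

end CHY

/-! ### The spinor curve of a solution and the kernel of ℭ₋ -/

noncomputable section

namespace CHY

open Polynomial Finset

/-- The product `∏_{c ≠ a} (σ_a - σ_c)`. -/
def nodeProd {ι : Type*} [Fintype ι] [DecidableEq ι] (σ : ι → ℂ) (a : ι) : ℂ :=
  ∏ c ∈ univ.erase a, (σ a - σ c)

theorem nodeProd_ne_zero {ι : Type*} [Fintype ι] [DecidableEq ι] {σ : ι → ℂ}
    (hσ : Function.Injective σ) (a : ι) : nodeProd σ a ≠ 0 :=
  Finset.prod_ne_zero_iff.2 fun _ hc => sub_ne_zero.2 (hσ.ne (Finset.ne_of_mem_erase hc).symm)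

theorem dot_vecMulVec (x y z w : Spinor) :
    dot (Matrix.vecMulVec x y) (Matrix.vecMulVec z w) = ang x z * sqb w y / 2 := by
  simp only [dot, ang, sqb, Matrix.vecMulVec_apply]
  ring

variable {n : ℕ}

theorem External.mandelstam_eq (E : External n) (a b : Fin n) :
    E.mandelstam a b = ang (E.lam a) (E.lam b) * sqb (E.lamt b) (E.lamt a) := by
  rw [External.mandelstam, External.mom, External.mom, dot_vecMulVec]
  ring

/-- The parity conjugate configuration. -/
def External.swap (E : External n) : External n where
  lam := E.lamt
  lamt := E.lam
  p := E.q
  q := E.p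
  neg := E.negᶜ

theorem ang_eq_neg_sqb (x y : Spinor) : ang x y = -sqb x y := by
  simp only [ang, sqb]; ring

/-- The momenta at the punctures `σ` factorize through spinor-valued polynomials `l`, `m` of
degrees at most `d`, `e`: `|a⟩ = t_a l(σ_a)` and `m(σ_a) = t_a ∏_{c ≠ a} (σ_a - σ_c) |a]`. -/
structure IsCurve (E : External n) (σ : Fin n → ℂ) (l m : Fin 2 → ℂ[X]) (t : Fin n → ℂ)
    (d e : ℕ) : Prop where
  inj : Function.Injective σ
  t_ne : ∀ a, t a ≠ 0
  lam_eq : ∀ a i, E.lam a i = t a * (l i).eval (σ a)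
  lamt_eq : ∀ a i, (m i).eval (σ a) = t a * nodeProd σ a * E.lamt a i
  deg_l : ∀ i, (l i).natDegree ≤ d
  deg_m : ∀ i, (m i).natDegree ≤ e
  deg_add : d + e + 2 ≤ n

/-- The value of `t_a² ⟨l(σ_a) l'(σ_a)⟩`. -/
def curvature (σ : Fin n → ℂ) (l : Fin 2 → ℂ[X]) (t : Fin n → ℂ) (a : Fin n) : ℂ :=
  t a ^ 2 * ((l 0).eval (σ a) * (derivative (l 1)).eval (σ a) -
    (l 1).eval (σ a) * (derivative (l 0)).eval (σ a))

namespace IsCurve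

variable {E : External n} {σ : Fin n → ℂ} {l m : Fin 2 → ℂ[X]} {t : Fin n → ℂ} {d e : ℕ}

theorem swap (h : IsCurve E σ l m t d e) :
    IsCurve E.swap σ m l (fun a => (t a * nodeProd σ a)⁻¹) e d where
  inj := h.inj
  t_ne a := inv_ne_zero (mul_ne_zero (h.t_ne a) (nodeProd_ne_zero h.inj a))
  lam_eq a i := by
    have := mul_ne_zero (h.t_ne a) (nodeProd_ne_zero h.inj a)
    rw [h.lamt_eq, inv_mul_cancel_left₀ this]
    rfl
  lamt_eq a i := by
    have h1 := h.t_ne a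
    have h2 := nodeProd_ne_zero h.inj a
    change _ = _ * E.lam a i
    rw [h.lam_eq]
    field_simp
  deg_l := h.deg_m
  deg_m := h.deg_l
  deg_add := by have := h.deg_add; omega

theorem ang_lam (h : IsCurve E σ l m t d e) (a b : Fin n) :
    ang (E.lam a) (E.lam b) = t a * t b *
      ((l 0).eval (σ a) * (l 1).eval (σ b) - (l 1).eval (σ a) * (l 0).eval (σ b)) := by
  simp only [ang, h.lam_eq]
  ring

/-- The bracket of the value of the curve at `σ_a` with the curve, times a polynomial, summed
against partial fraction weights. -/
theorem sum_ang_mul (h : IsCurve E σ l m t d e) {s : ℕ} {g : Fin s → Fin n}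
    (hg : Function.Injective g) {f : ℂ[X]} (hf : f.degree < (s - d : ℕ)) (a : Fin s) :
    ∑ b ∈ univ.erase a, ang (E.lam (g a)) (E.lam (g b)) *
        (f.eval (σ (g b)) / (t (g b) * nodeProd (σ ∘ g) b)) / (σ (g a) - σ (g b)) =
      curvature σ l t (g a) * (f.eval (σ (g a)) / (t (g a) * nodeProd (σ ∘ g) a)) := by
  -- G = ⟨l(σ_a) l⟩ f vanishes at σ_a, has degree < s, and its derivative there is ⟨l l'⟩ f. If s ≤
  -- d, truncated subtraction forces f = 0.
  let G : ℂ[X] := (C ((l 0).eval (σ (g a))) * l 1 - C ((l 1).eval (σ (g a))) * l 0) * f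
  have hG : G.degree < Fintype.card (Fin s) := by
    rw [Fintype.card_fin]
    by_cases hf0 : f = 0
    · simp [G, hf0, bot_lt_iff_ne_bot]
    have hfd : f.natDegree < s - d := by
      rw [degree_eq_natDegree hf0] at hf
      exact_mod_cast hf
    have hl : ∀ (c : ℂ) i, (C c * l i).natDegree ≤ d := fun c i =>
      (natDegree_C_mul_le _ _).trans (h.deg_l i)
    have : G.natDegree < s := by
      refine lt_of_le_of_lt natDegree_mul_le ?_
      have := (natDegree_sub_le (C ((l 0).eval (σ (g a))) * l 1)
        (C ((l 1).eval (σ (g a))) * l 0)).trans (max_le (hl _ _) (hl _ _))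
      omega
    exact degree_le_natDegree.trans_lt (by exact_mod_cast this)
  have key := sum_eval_div_eq_derivative_eval (σ := σ ∘ g) (h.inj.comp hg) (G := G) hG (a := a)
    (by simp [G]; left; ring)
  simp only [Function.comp_apply] at key
  have hta := h.t_ne (g a)
  calc _ = t (g a) * ∑ b ∈ univ.erase a, G.eval (σ (g b)) /
          (∏ c ∈ univ.erase b, (σ (g b) - σ (g c))) / (σ (g a) - σ (g b)) := by
        rw [Finset.mul_sum]
        refine Finset.sum_congr rfl fun b _ => ?_
        have htb := h.t_ne (g b)
        rw [h.ang_lam]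
        simp only [G, nodeProd, Function.comp_apply, eval_mul, eval_sub, eval_C]
        field_simp
    _ = _ := by
        rw [key]
        simp only [G, nodeProd, curvature, Function.comp_apply, derivative_mul, derivative_sub,
          derivative_C, zero_mul, zero_add, eval_add, eval_mul, eval_sub, eval_C]
        field_simp
        ring

/-- The case f = m_i of `sum_ang_mul`, admissible since e < n - d. It makes the diagonal of ℭ₋
independent of |q]. -/
theorem sum_ang_mul_lamt (h : IsCurve E σ l m t d e) (a : Fin n) (i : Fin 2) :
    ∑ c ∈ univ.erase a, ang (E.lam a) (E.lam c) * E.lamt c i / (σ a - σ c) =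
      curvature σ l t a * E.lamt a i := by
  have hdeg : (m i).degree < (n - d : ℕ) := by
    refine degree_le_natDegree.trans_lt ?_
    have := h.deg_m i
    have := h.deg_add
    exact_mod_cast (by omega : (m i).natDegree < n - d)
  have key := h.sum_ang_mul (g := id) Function.injective_id hdeg a
  have hm : ∀ b, (m i).eval (σ b) / (t b * nodeProd σ b) = E.lamt b i := fun b => by
    rw [h.lamt_eq, mul_div_cancel_left₀]
    exact mul_ne_zero (h.t_ne b) (nodeProd_ne_zero h.inj b)
  simpa only [id, Function.comp_id, hm] using key

theorem sum_ang_mul_sqb (h : IsCurve E σ l m t d e) (a : Fin n) (q : Spinor) :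
    ∑ c ∈ univ.erase a, ang (E.lam a) (E.lam c) * sqb (E.lamt c) q / (σ a - σ c) =
      curvature σ l t a * sqb (E.lamt a) q := by
  have h0 := h.sum_ang_mul_lamt a 0
  have h1 := h.sum_ang_mul_lamt a 1
  calc _ = ∑ c ∈ univ.erase a, (ang (E.lam a) (E.lam c) * E.lamt c 1 / (σ a - σ c) * q 0 -
        ang (E.lam a) (E.lam c) * E.lamt c 0 / (σ a - σ c) * q 1) :=
        Finset.sum_congr rfl fun c _ => by simp only [sqb]; ring
    _ = _ := by
        rw [Finset.sum_sub_distrib, ← Finset.sum_mul, ← Finset.sum_mul, h0, h1]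
        simp only [sqb]
        ring

theorem discMinus_diag (h : IsCurve E σ l m t d e) (hE : E.Admissible) (a : Fin n) :
    E.discMinus σ a a = -curvature σ l t a := by
  have := hE.sqb_ne_zero a
  simp only [External.discMinus, Matrix.of_apply, if_true]
  rw [neg_inj, ← mul_left_inj' this, ← h.sum_ang_mul_sqb, Finset.sum_mul]
  exact Finset.sum_congr rfl fun c _ => by field_simp

theorem discMinus_mulVec (h : IsCurve E σ l m t d e) (hE : E.Admissible) (u : Fin n → ℂ)
    (a : Fin n) : (E.discMinus σ).mulVec u a =
      ∑ b ∈ univ.erase a, ang (E.lam a) (E.lam b) * u b / (σ a - σ b) -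
        curvature σ l t a * u a := by
  rw [Matrix.mulVec, dotProduct, ← Finset.sum_erase_add _ _ (Finset.mem_univ a),
    h.discMinus_diag hE, neg_mul, ← sub_eq_add_neg]
  congr 1
  refine Finset.sum_congr rfl fun b hb => ?_
  simp only [External.discMinus, Matrix.of_apply, if_neg (Finset.ne_of_mem_erase hb).symm]
  ring

/-- The map from polynomials of degree less than `n - d` onto the kernel of `ℭ₋`. -/
def kernelMap (σ : Fin n → ℂ) (t : Fin n → ℂ) (k : ℕ) : degreeLT ℂ k →ₗ[ℂ] (Fin n → ℂ) where
  toFun f b := f.1.eval (σ b) / (t b * nodeProd σ b)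
  map_add' f g := by ext b; simp [add_div]
  map_smul' c f := by ext b; simp [mul_div_assoc]

/-- With κ_b = (l_0 |b⟩_1 - l_1 |b⟩_0) / (X - σ_b), the polynomial ∑ u_b κ_b takes the value (ℭ₋u)_a
/ t_a at σ_a, so it vanishes at n nodes and is zero. Multiplied by ∏ (X - σ_c), this says that W = ∑
u_b |b⟩ ∏_{c ≠ b} (X - σ_c) is parallel to l. Coprimality gives W = l f, and f is the polynomial
sought. -/
theorem exists_eq_mul_of_discMinus_mulVec_eq_zero (h : IsCurve E σ l m t d e)
    (hE : E.Admissible) (hcop : IsCoprime (l 0) (l 1)) (hd : ∃ i, (l i).natDegree = d ∧ l i ≠ 0)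
    {u : Fin n → ℂ} (hu : (E.discMinus σ).mulVec u = 0) :
    ∃ f : ℂ[X], f.degree < (n - d : ℕ) ∧
      u = fun b => f.eval (σ b) / (t b * nodeProd σ b) := by
  have hK : ∀ b, ∃ κ : ℂ[X], l 0 * C (E.lam b 1) - l 1 * C (E.lam b 0) = (X - C (σ b)) * κ := by
    intro b
    refine dvd_iff_isRoot.2 ?_
    simp only [IsRoot, eval_sub, eval_mul, eval_C, h.lam_eq]
    ring
  choose κ hκ using hK
  have hn := h.deg_add
  have hκdeg : ∀ b, (κ b).degree < (n : ℕ) := by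
    intro b
    by_cases h0 : κ b = 0
    · simp [h0, bot_lt_iff_ne_bot]
    have h1 : ((X - C (σ b)) * κ b).natDegree ≤ d := by
      rw [← hκ]
      exact (natDegree_sub_le _ _).trans (max_le ((natDegree_mul_C_le _ _).trans (h.deg_l 0))
        ((natDegree_mul_C_le _ _).trans (h.deg_l 1)))
    exact degree_le_natDegree.trans_lt (by
      rw [natDegree_mul (X_sub_C_ne_zero _) h0, natDegree_X_sub_C] at h1
      exact_mod_cast (by omega : (κ b).natDegree < n))
  have hsum : ∑ b, C (u b) * κ b = 0 := by
    refine eq_zero_of_degree_lt_of_eval_index_eq_zero univ h.inj.injOn ?_ fun a _ => ?_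
    · rw [Finset.card_univ, Fintype.card_fin]
      refine (degree_sum_le _ _).trans_lt ?_
      rw [Finset.sup_lt_iff (bot_lt_iff_ne_bot.2 (by simp))]
      intro b _
      rw [← smul_eq_C_mul]
      exact (degree_smul_le _ _).trans_lt (hκdeg b)
    · have h1 : ∀ b, b ≠ a → t a * (κ b).eval (σ a) =
          ang (E.lam a) (E.lam b) / (σ a - σ b) := by
        intro b hb
        have hne : σ a - σ b ≠ 0 := sub_ne_zero.2 (h.inj.ne hb.symm)
        have := congrArg (eval (σ a)) (hκ b)
        simp only [eval_sub, eval_mul, eval_C, eval_X] at this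
        rw [eq_div_iff hne]
        simp only [ang]
        rw [h.lam_eq a 0, h.lam_eq a 1]
        linear_combination -t a * this
      have h2 : t a * (κ a).eval (σ a) = -curvature σ l t a := by
        have := congrArg (fun p => eval (σ a) (derivative p)) (hκ a)
        simp only [eval_sub, eval_mul, eval_C, eval_X, derivative_mul, derivative_sub,
          derivative_X, derivative_C, eval_add, sub_self, zero_mul, add_zero, mul_zero,
          sub_zero, one_mul, h.lam_eq] at this
        rw [← this, curvature]
        ring
      have h3 := congrFun hu a
      rw [h.discMinus_mulVec hE, Pi.zero_apply] at h3
      rw [← mul_right_inj' (h.t_ne a), mul_zero, ← h3, eval_finsetSum,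
        ← Finset.sum_erase_add _ _ (Finset.mem_univ a), mul_add, Finset.mul_sum, sub_eq_add_neg]
      congr 1
      · refine Finset.sum_congr rfl fun b hb => ?_
        rw [eval_mul, eval_C]
        linear_combination u b * h1 b (Finset.ne_of_mem_erase hb)
      · rw [eval_mul, eval_C]
        linear_combination u a * h2
  let D : Fin n → ℂ[X] := fun b => ∏ c ∈ univ.erase b, (X - C (σ c))
  let W : Fin 2 → ℂ[X] := fun i => ∑ b, C (u b * E.lam b i) * D b
  have hW : l 0 * W 1 = l 1 * W 0 := by
    rw [← sub_eq_zero]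
    calc l 0 * W 1 - l 1 * W 0
        = ∑ b, C (u b) * (l 0 * C (E.lam b 1) - l 1 * C (E.lam b 0)) * D b := by
          simp only [W, Finset.mul_sum, C_mul]
          rw [← Finset.sum_sub_distrib]
          exact Finset.sum_congr rfl fun b _ => by ring
      _ = ∑ b, (C (u b) * κ b) * ∏ c, (X - C (σ c)) := by
          refine Finset.sum_congr rfl fun b _ => ?_
          rw [hκ, ← Finset.mul_prod_erase _ _ (Finset.mem_univ b)]
          ring
      _ = 0 := by rw [← Finset.sum_mul, hsum, zero_mul]
  obtain ⟨x, y, hxy⟩ := hcop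
  let f : ℂ[X] := x * W 0 + y * W 1
  have hf : ∀ i, W i = l i * f := by
    have h0 : W 0 = l 0 * f := by linear_combination (-W 0) * hxy - y * hW
    have h1 : W 1 = l 1 * f := by linear_combination (-W 1) * hxy + x * hW
    intro i
    fin_cases i
    exacts [h0, h1]
  have hWdeg : ∀ i, (W i).natDegree ≤ n - 1 := by
    intro i
    refine natDegree_sum_le_of_forall_le _ _ fun b _ => ?_
    refine (natDegree_C_mul_le _ _).trans ?_
    rw [natDegree_finsetProd_X_sub_C_eq_card, Finset.card_erase_of_mem (Finset.mem_univ b),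
      Finset.card_univ, Fintype.card_fin]
  refine ⟨f, ?_, ?_⟩
  · by_cases hf0 : f = 0
    · simp [hf0, bot_lt_iff_ne_bot]
    obtain ⟨i, hi, hi0⟩ := hd
    have := hWdeg i
    rw [hf, natDegree_mul hi0 hf0, hi] at this
    exact degree_le_natDegree.trans_lt (by exact_mod_cast (by omega : f.natDegree < n - d))
  · have hWe : ∀ i a, (W i).eval (σ a) = u a * E.lam a i * nodeProd σ a := by
      intro i a
      simp only [W, eval_finsetSum, eval_mul, eval_C, D, eval_prod, eval_sub, eval_X]
      rw [Finset.sum_eq_single a]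
      · rfl
      · intro b _ hb
        rw [Finset.prod_eq_zero (Finset.mem_erase.2 ⟨hb.symm, Finset.mem_univ a⟩) (sub_self _),
          mul_zero]
      · simp
    funext a
    have hta := h.t_ne a
    have hD := nodeProd_ne_zero h.inj a
    rw [eq_div_iff (mul_ne_zero hta hD)]
    -- The Bézout relation at σ_a then allows l(σ_a) to be cancelled.
    have hval : ∀ i, (l i).eval (σ a) * (f.eval (σ a)) =
        (l i).eval (σ a) * (u a * (t a * nodeProd σ a)) := by
      intro i
      rw [← eval_mul, ← hf, hWe, h.lam_eq]
      ring
    have hx := congrArg (eval (σ a)) hxy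
    simp only [eval_add, eval_mul, eval_one] at hx
    linear_combination (-x.eval (σ a)) * hval 0 - y.eval (σ a) * hval 1 +
      (f.eval (σ a) - u a * (t a * nodeProd σ a)) * hx

theorem rank_discMinus (h : IsCurve E σ l m t d e) (hE : E.Admissible)
    (hcop : IsCoprime (l 0) (l 1)) (hd : ∃ i, (l i).natDegree = d ∧ l i ≠ 0) :
    (E.discMinus σ).rank = d := by
  have hinj : Function.Injective (kernelMap σ t (n - d)) := by
    rw [← LinearMap.ker_eq_bot, LinearMap.ker_eq_bot']
    rintro ⟨f, hf⟩ h0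
    rw [mem_degreeLT] at hf
    refine Subtype.ext (eq_zero_of_degree_lt_of_eval_index_eq_zero univ h.inj.injOn ?_
      fun a _ => ?_)
    · rw [Finset.card_univ, Fintype.card_fin]
      exact hf.trans_le (by exact_mod_cast Nat.sub_le n d)
    · have := congrFun h0 a
      simpa [kernelMap, h.t_ne a, nodeProd_ne_zero h.inj a] using this
  have hker : LinearMap.ker (E.discMinus σ).mulVecLin = LinearMap.range (kernelMap σ t (n - d)) := by
    ext u
    rw [LinearMap.mem_ker, Matrix.mulVecLin_apply, LinearMap.mem_range]
    constructor
    · intro hu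
      obtain ⟨f, hf, rfl⟩ := h.exists_eq_mul_of_discMinus_mulVec_eq_zero hE hcop hd hu
      exact ⟨⟨f, mem_degreeLT.2 hf⟩, rfl⟩
    · rintro ⟨f, rfl⟩
      funext a
      rw [h.discMinus_mulVec hE, Pi.zero_apply, sub_eq_zero]
      exact h.sum_ang_mul (g := id) Function.injective_id (mem_degreeLT.1 f.2) a
  have h1 := LinearMap.finrank_range_add_finrank_ker (E.discMinus σ).mulVecLin
  rw [hker, LinearMap.finrank_range_of_inj hinj, (degreeLTEquiv ℂ (n - d)).finrank_eq,
    Module.finrank_fin_fun, Module.finrank_fin_fun] at h1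
  rw [Matrix.rank]
  have := h.deg_add
  omega

end IsCurve

/-! ### Factorization of the momentum matrix -/

namespace External

variable {E : External n} {σ : Fin n → ℂ}

theorem Admissible.lam_ne_zero (hE : E.Admissible) (a : Fin n) : ∃ i, E.lam a i ≠ 0 := by
  by_contra! h
  exact hE.ang_ne_zero a (by simp [ang, h])

theorem Admissible.lamt_ne_zero (hE : E.Admissible) (a : Fin n) : ∃ i, E.lamt a i ≠ 0 := by
  by_contra! h
  exact hE.sqb_ne_zero a (by simp [sqb, h])

theorem mandelstam_symm (E : External n) (a b : Fin n) :
    E.mandelstam a b = E.mandelstam b a := by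
  simp only [mandelstam_eq, ang, sqb]; ring

theorem mandelstam_self (E : External n) (a : Fin n) : E.mandelstam a a = 0 := by
  simp only [mandelstam_eq, ang, sqb]; ring

/-- On a solution of the scattering equations the vector `∑ k_c / (z - σ_c)` is null. -/
theorem null_of_mem_solutions (hσ : σ ∈ E.solutions) {z : ℂ} (hz : ∀ c, z ≠ σ c) :
    (∑ c, E.mom c 0 0 / (z - σ c)) * (∑ c, E.mom c 1 1 / (z - σ c)) =
      (∑ c, E.mom c 0 1 / (z - σ c)) * (∑ c, E.mom c 1 0 / (z - σ c)) := by
  have hF : ∀ a, ∑ b, E.mandelstam a b / (σ a - σ b) = 0 := by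
    intro a
    rw [← hσ.2 a, ← Finset.sum_erase_add _ _ (Finset.mem_univ a), sub_self, div_zero, add_zero]
  -- Double poles are absent because s_aa = 0; the residues at the simple poles are the scattering
  -- equations.
  have hterm : ∀ a b, E.mandelstam a b / ((z - σ a) * (z - σ b)) =
      E.mandelstam a b / (σ a - σ b) * (z - σ a)⁻¹ +
        E.mandelstam b a / (σ b - σ a) * (z - σ b)⁻¹ := by
    intro a b
    have h1 := sub_ne_zero.2 (hz a)
    have h2 := sub_ne_zero.2 (hz b)
    rcases eq_or_ne a b with rfl | hab
    · simp [mandelstam_self]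
    have h3 : σ a - σ b ≠ 0 := sub_ne_zero.2 (hσ.1.ne hab)
    have h4 : σ b - σ a ≠ 0 := sub_ne_zero.2 (hσ.1.ne hab.symm)
    rw [mandelstam_symm E b a]
    rw [← neg_sub (σ a) (σ b)]
    field_simp
    ring
  have hzero : ∑ a, ∑ b, E.mandelstam a b / ((z - σ a) * (z - σ b)) = 0 := by
    simp only [hterm, Finset.sum_add_distrib, ← Finset.sum_mul, hF, zero_mul, zero_add]
    rw [Finset.sum_comm]
    simp only [← Finset.sum_mul, hF, zero_mul, Finset.sum_const_zero]
  have hexp : ∑ a, ∑ b, E.mandelstam a b / ((z - σ a) * (z - σ b)) =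
      (∑ c, E.mom c 0 0 / (z - σ c)) * (∑ c, E.mom c 1 1 / (z - σ c)) +
      (∑ c, E.mom c 1 1 / (z - σ c)) * (∑ c, E.mom c 0 0 / (z - σ c)) -
      (∑ c, E.mom c 0 1 / (z - σ c)) * (∑ c, E.mom c 1 0 / (z - σ c)) -
      (∑ c, E.mom c 1 0 / (z - σ c)) * (∑ c, E.mom c 0 1 / (z - σ c)) := by
    simp only [Finset.sum_mul_sum, ← Finset.sum_add_distrib, ← Finset.sum_sub_distrib]
    refine Finset.sum_congr rfl fun a _ => Finset.sum_congr rfl fun b _ => ?_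
    simp only [mandelstam, dot, div_eq_mul_inv, mul_inv]
    ring
  linear_combination (hexp.symm.trans hzero) / 2

/-- The polynomial `∑_c k_c ∏_{e ≠ c} (X - σ_e)`. -/
def momPoly (E : External n) (σ : Fin n → ℂ) (i j : Fin 2) : ℂ[X] :=
  ∑ c, C (E.mom c i j) * ∏ e ∈ univ.erase c, (X - C (σ e))

theorem momPoly_eval_node (E : External n) (σ : Fin n → ℂ) (i j : Fin 2) (a : Fin n) :
    (E.momPoly σ i j).eval (σ a) = E.lam a i * E.lamt a j * nodeProd σ a := by
  simp only [momPoly, eval_finsetSum, eval_mul, eval_C, eval_prod, eval_sub, eval_X]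
  rw [Finset.sum_eq_single a]
  · rfl
  · intro b _ hb
    rw [Finset.prod_eq_zero (Finset.mem_erase.2 ⟨hb.symm, Finset.mem_univ a⟩) (sub_self _),
      mul_zero]
  · simp

theorem momPoly_eval (E : External n) {σ : Fin n → ℂ} (i j : Fin 2) {z : ℂ}
    (hz : ∀ c, z ≠ σ c) : (E.momPoly σ i j).eval z =
      (∏ c, (z - σ c)) * ∑ c, E.mom c i j / (z - σ c) := by
  simp only [momPoly, eval_finsetSum, eval_mul, eval_C, eval_prod, eval_sub, eval_X,
    Finset.mul_sum]
  refine Finset.sum_congr rfl fun c _ => ?_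
  have := sub_ne_zero.2 (hz c)
  rw [← Finset.mul_prod_erase _ _ (Finset.mem_univ c)]
  field_simp

theorem momPoly_det (hσ : σ ∈ E.solutions) :
    E.momPoly σ 0 0 * E.momPoly σ 1 1 = E.momPoly σ 0 1 * E.momPoly σ 1 0 := by
  refine eq_of_infinite_eval_eq _ _ ((Set.finite_range σ).infinite_compl.mono fun z hz => ?_)
  have hz' : ∀ c, z ≠ σ c := fun c h => hz ⟨c, h.symm⟩
  simp only [Set.mem_ofPred_eq, eval_mul, E.momPoly_eval _ _ hz']
  linear_combination (∏ c, (z - σ c)) ^ 2 * null_of_mem_solutions hσ hz'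

/-- The coefficient of X^(n-1) is the total momentum. -/
theorem natDegree_momPoly (hE : E.Admissible) (σ : Fin n → ℂ) (i j : Fin 2) :
    (E.momPoly σ i j).natDegree ≤ n - 2 := by
  rw [natDegree_le_iff_coeff_eq_zero]
  intro N hN
  have hcoeff : ∀ c, (∏ e ∈ univ.erase c, (X - C (σ e))).coeff N =
      if N = n - 1 then 1 else 0 := by
    intro c
    have hdeg : (∏ e ∈ univ.erase c, (X - C (σ e))).natDegree = n - 1 := by
      rw [natDegree_finsetProd_X_sub_C_eq_card, Finset.card_erase_of_mem (Finset.mem_univ c),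
        Finset.card_univ, Fintype.card_fin]
    split_ifs with h
    · rw [h, ← hdeg]
      exact monic_prod_X_sub_C _ _
    · exact coeff_eq_zero_of_natDegree_lt (by omega)
  have hcons : ∑ c, E.mom c i j = 0 := by
    have := congrFun (congrFun hE.conservation i) j
    rwa [Matrix.sum_apply] at this
  simp only [momPoly, finsetSum_coeff, coeff_C_mul, hcoeff]
  rw [← Finset.sum_mul, hcons, zero_mul]

/-- A singular 2 × 2 matrix over ℂ[X] is a product of a column and a row: l is the first column
divided by its gcd, m_0 is that gcd, and Bézout coefficients supply m_1. -/
theorem exists_isCurve (hn : 4 ≤ n) (hE : E.Admissible) (hσ : σ ∈ E.solutions) :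
    ∃ (l m : Fin 2 → ℂ[X]) (t : Fin n → ℂ) (d e : ℕ), IsCurve E σ l m t d e ∧
      IsCoprime (l 0) (l 1) ∧ ∃ i, (l i).natDegree = d ∧ l i ≠ 0 := by
  let M := E.momPoly σ
  have hDne := nodeProd_ne_zero hσ.1
  -- A zero first column would make all |a] proportional, so every s_ab would vanish.
  have hg : EuclideanDomain.gcd (M 0 0) (M 1 0) ≠ 0 := by
    intro h0
    rw [EuclideanDomain.gcd_eq_zero_iff] at h0
    have hM : ∀ i, M i 0 = 0 := fun i => by fin_cases i; exacts [h0.1, h0.2]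
    have hl : ∀ a, E.lamt a 0 = 0 := by
      intro a
      obtain ⟨i, hi⟩ := hE.lam_ne_zero a
      have := E.momPoly_eval_node σ i 0 a
      rw [show E.momPoly σ i 0 = 0 from hM i, eval_zero] at this
      simpa [hi, hDne a] using this.symm
    refine hE.mandelstam_ne_zero ⟨0, by omega⟩ ⟨1, by omega⟩ (by simp) ?_
    simp [mandelstam_eq, sqb, hl]
  set g := EuclideanDomain.gcd (M 0 0) (M 1 0) with hgdef
  obtain ⟨l0, hl0⟩ : g ∣ M 0 0 := EuclideanDomain.gcd_dvd_left _ _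
  obtain ⟨l1, hl1⟩ : g ∣ M 1 0 := EuclideanDomain.gcd_dvd_right _ _
  obtain ⟨x, y, hxy⟩ : IsCoprime l0 l1 := by
    refine ⟨EuclideanDomain.gcdA (M 0 0) (M 1 0), EuclideanDomain.gcdB (M 0 0) (M 1 0), ?_⟩
    have := EuclideanDomain.gcd_eq_gcd_ab (M 0 0) (M 1 0)
    rw [← hgdef] at this
    refine mul_left_cancel₀ hg ?_
    linear_combination -this -
      EuclideanDomain.gcdA (M 0 0) (M 1 0) * hl0 - EuclideanDomain.gcdB (M 0 0) (M 1 0) * hl1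
  have hdet : l0 * M 1 1 = l1 * M 0 1 := by
    have : M 0 0 * M 1 1 = M 0 1 * M 1 0 := momPoly_det hσ
    refine mul_left_cancel₀ hg ?_
    linear_combination this - M 1 1 * hl0 + M 0 1 * hl1
  let l : Fin 2 → ℂ[X] := ![l0, l1]
  let m : Fin 2 → ℂ[X] := ![g, x * M 0 1 + y * M 1 1]
  have hfac : ∀ i j, M i j = l i * m j := by
    intro i j
    fin_cases i <;> fin_cases j
    · change M 0 0 = l0 * g
      rw [hl0, mul_comm]
    · change M 0 1 = l0 * (x * M 0 1 + y * M 1 1)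
      linear_combination (-M 0 1) * hxy - y * hdet
    · change M 1 0 = l1 * g
      rw [hl1, mul_comm]
    · change M 1 1 = l1 * (x * M 0 1 + y * M 1 1)
      linear_combination (-M 1 1) * hxy + x * hdet
  have hval : ∀ a i j, (l i).eval (σ a) * (m j).eval (σ a) =
      E.lam a i * E.lamt a j * nodeProd σ a := by
    intro a i j
    rw [← eval_mul, ← hfac]
    exact E.momPoly_eval_node σ i j a
  have ht : ∀ a, ∃ t : ℂ, t ≠ 0 ∧ (∀ i, E.lam a i = t * (l i).eval (σ a)) ∧
      ∀ i, (m i).eval (σ a) = t * nodeProd σ a * E.lamt a i := by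
    intro a
    obtain ⟨i, hi⟩ := hE.lam_ne_zero a
    obtain ⟨j, hj⟩ := hE.lamt_ne_zero a
    have hD := hDne a
    have hlm : (l i).eval (σ a) * (m j).eval (σ a) ≠ 0 := by
      rw [hval]
      exact mul_ne_zero (mul_ne_zero hi hj) hD
    have hli := left_ne_zero_of_mul hlm
    have hmj := right_ne_zero_of_mul hlm
    have hlam : ∀ i, E.lam a i =
        (m j).eval (σ a) / (E.lamt a j * nodeProd σ a) * (l i).eval (σ a) := by
      intro i
      rw [div_mul_eq_mul_div, eq_div_iff (mul_ne_zero hj hD)]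
      linear_combination -hval a i j
    refine ⟨(m j).eval (σ a) / (E.lamt a j * nodeProd σ a),
      div_ne_zero hmj (mul_ne_zero hj hD), hlam, fun k => ?_⟩
    have h1 := hval a i k
    rw [hlam i] at h1
    refine mul_left_cancel₀ hli ?_
    linear_combination h1
  choose t ht0 ht1 ht2 using ht
  -- Nonzero components of maximal degree are needed so that the degrees of l and m add in an entry
  -- l_i m_j.
  have hne : ∀ p : Fin 2 → ℂ[X], (∃ i, p i ≠ 0) → ∃ i, p i ≠ 0 ∧ ∀ k, (p k).natDegree ≤
      (p i).natDegree := by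
    rintro p ⟨i, hi⟩
    obtain ⟨j, -, hj⟩ := Finset.exists_max_image univ (fun k => (p k).natDegree) ⟨i, mem_univ i⟩
    by_cases hpj : p j = 0
    · refine ⟨i, hi, fun k => (hj k (mem_univ k)).trans ?_⟩
      simp [hpj]
    · exact ⟨j, hpj, fun k => hj k (mem_univ k)⟩
  have hlne : ∃ i, l i ≠ 0 := by
    by_contra! h
    have h0 : l0 = 0 := h 0
    have h1 : l1 = 0 := h 1
    simp [h0, h1] at hxy
  obtain ⟨i, hi, hil⟩ := hne l hlne
  obtain ⟨j, hj, hjm⟩ := hne m ⟨0, hg⟩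
  refine ⟨l, m, t, (l i).natDegree, (m j).natDegree, ⟨hσ.1, ht0, ht1, ht2, hil, hjm, ?_⟩,
    ⟨x, y, hxy⟩, i, rfl, hi⟩
  have := natDegree_momPoly hE σ i j
  rw [show E.momPoly σ i j = l i * m j from hfac i j, natDegree_mul hi hj] at this
  omega

end External

namespace IsCurve

variable {E : External n} {σ : Fin n → ℂ} {l m : Fin 2 → ℂ[X]} {t : Fin n → ℂ} {d e : ℕ}

/-- A constant l would make all |a⟩ proportional. Applied to the parity conjugate, this bounds e. -/
theorem one_le_deg (h : IsCurve E σ l m t d e) (hn : 4 ≤ n) (hE : E.Admissible) : 1 ≤ d := by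
  by_contra hd
  have hl : ∀ i, l i = C ((l i).coeff 0) := fun i =>
    eq_C_of_natDegree_eq_zero (by have := h.deg_l i; omega)
  refine hE.mandelstam_ne_zero ⟨0, by omega⟩ ⟨1, by omega⟩ (by simp) ?_
  rw [External.mandelstam_eq, h.ang_lam, hl 0, hl 1]
  simp only [eval_C]
  ring

end IsCurve

/-! ### Parity and the entries of Ψ -/

theorem External.Admissible.swap {E : External n} (hE : E.Admissible) : E.swap.Admissible where
  conservation := by
    have := congrArg Matrix.transpose hE.conservation
    rw [Matrix.transpose_sum, Matrix.transpose_zero] at this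
    rw [← this]
    exact Finset.sum_congr rfl fun a _ => (Matrix.transpose_vecMulVec _ _).symm
  mandelstam_ne_zero a b hab := by
    have := hE.mandelstam_ne_zero a b hab
    rw [External.mandelstam_eq] at this ⊢
    refine fun h => this ?_
    simp only [External.swap, ang, sqb] at h ⊢
    linear_combination h
  ang_ne_zero a := by
    have := hE.sqb_ne_zero a
    rw [ang_eq_neg_sqb]
    exact neg_ne_zero.2 this
  sqb_ne_zero a := by
    have := hE.ang_ne_zero a
    rw [ang_eq_neg_sqb] at this
    exact neg_ne_zero.1 this

theorem dot_comm (v w : FourVec) : dot v w = dot w v := by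
  simp only [dot]; ring

theorem dot_smul_left (c : ℂ) (v w : FourVec) : dot (c • v) w = c * dot v w := by
  simp only [dot, Matrix.smul_apply, smul_eq_mul]; ring

theorem dot_smul_right (c : ℂ) (v w : FourVec) : dot v (c • w) = c * dot v w := by
  rw [dot_comm, dot_smul_left, dot_comm]

theorem dot_neg_left (v w : FourVec) : dot (-v) w = -dot v w := by
  simp only [dot, Matrix.neg_apply]; ring

theorem dot_transpose (v w : FourVec) : dot v.transpose w.transpose = dot v w := by
  simp only [dot, Matrix.transpose_apply]; ring

theorem sqb_symm (x y : Spinor) : sqb x y = -sqb y x := by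
  simp only [sqb]; ring

namespace External

variable (E : External n) (σ : Fin n → ℂ)

theorem matPsi_antisymm (a b : Fin n ⊕ Fin n) : E.matPsi σ b a = -E.matPsi σ a b := by
  rcases a with a | a <;> rcases b with b | b
  · simp only [matPsi, Matrix.fromBlocks_apply₁₁, matA, Matrix.of_apply, eq_comm (a := b)]
    split_ifs
    · simp
    · rw [E.mandelstam_symm b a, ← neg_sub (σ a), div_neg]
  · simp [matPsi]
  · simp [matPsi]
  · simp only [matPsi, Matrix.fromBlocks_apply₂₂, matB, Matrix.of_apply, eq_comm (a := b)]
    split_ifs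
    · simp
    · rw [dot_comm, ← neg_sub (σ a), div_neg]

/-- The sign of a row of `Ψ` under parity. -/
def paritySign : Fin n ⊕ Fin n → ℂ := Sum.elim (fun _ => 1) (fun _ => -1)

theorem swap_mom (a : Fin n) : E.swap.mom a = (E.mom a).transpose :=
  (Matrix.transpose_vecMulVec _ _).symm

theorem swap_pol (a : Fin n) : E.swap.pol a = -(E.pol a).transpose := by
  have hneg : a ∈ E.swap.neg ↔ a ∉ E.neg := Finset.mem_compl
  simp only [pol, hneg]
  by_cases h : a ∈ E.neg
  · rw [if_neg (not_not.2 h), if_pos h, Matrix.transpose_smul, Matrix.transpose_vecMulVec,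
      ← neg_smul, ang_eq_neg_sqb, mul_neg, div_neg]
    rfl
  · rw [if_pos h, if_neg h, Matrix.transpose_smul, Matrix.transpose_vecMulVec, ← neg_smul,
      ang_eq_neg_sqb, mul_neg, div_neg, neg_neg]
    rfl

/-- Parity transposes momenta, and transposes and negates polarizations, so only the block `C`
changes sign. -/
theorem swap_matPsi (a b : Fin n ⊕ Fin n) :
    E.swap.matPsi σ a b = paritySign a * paritySign b * E.matPsi σ a b := by
  have hk : ∀ a b, dot (E.swap.mom a) (E.swap.mom b) = dot (E.mom a) (E.mom b) := fun a b => by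
    rw [swap_mom, swap_mom, dot_transpose]
  have he : ∀ a b, dot (E.swap.pol a) (E.swap.mom b) = -dot (E.pol a) (E.mom b) := fun a b => by
    rw [swap_mom, swap_pol, dot_neg_left, dot_transpose]
  have hee : ∀ a b, dot (E.swap.pol a) (E.swap.pol b) = dot (E.pol a) (E.pol b) := fun a b => by
    rw [swap_pol, swap_pol, dot_neg_left, dot_comm, dot_neg_left, dot_transpose, dot_comm, neg_neg]
  have hC : ∀ a b, E.swap.matC σ a b = -E.matC σ a b := by
    intro a b
    simp only [matC, Matrix.of_apply, he]
    split_ifs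
    · rw [← Finset.sum_neg_distrib]
      exact Finset.sum_congr rfl fun c _ => by ring
    · ring
  rcases a with a | a <;> rcases b with b | b
  · simp [matPsi, matA, mandelstam, hk, paritySign]
  · simp [matPsi, paritySign, hC]
  · simp [matPsi, paritySign, hC]
  · simp [matPsi, matB, paritySign, hee]

variable {E} {σ}

theorem sqrt_two_mul_pol_dot {a : Fin n} (ha : a ∈ E.neg) (x y : Spinor) :
    (Real.sqrt 2 : ℂ) * dot (E.pol a) (Matrix.vecMulVec x y) =
      -(ang (E.lam a) x * sqb y E.q / sqb (E.lamt a) E.q) := by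
  have h2 : (Real.sqrt 2 : ℂ) ≠ 0 := by simp
  rw [pol, if_pos ha, dot_smul_left, dot_vecMulVec, sqb_symm E.q]
  by_cases h : sqb (E.lamt a) E.q = 0
  · simp [h]
  · field_simp

theorem matC_of_mem_neg {a b : Fin n} (ha : a ∈ E.neg) (hab : a ≠ b) :
    E.matC σ a b =
      ang (E.lam a) (E.lam b) * sqb (E.lamt b) E.q / sqb (E.lamt a) E.q / (σ a - σ b) := by
  rw [matC, Matrix.of_apply, if_neg hab, mom, sqrt_two_mul_pol_dot ha, neg_div, neg_neg]

theorem matC_self_of_mem_neg {a : Fin n} (ha : a ∈ E.neg) :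
    E.matC σ a a = E.discMinus σ a a := by
  rw [matC, discMinus, Matrix.of_apply, Matrix.of_apply, if_pos rfl, if_pos rfl,
    ← Finset.sum_neg_distrib]
  refine Finset.sum_congr rfl fun c _ => ?_
  rw [mom, sqrt_two_mul_pol_dot ha, neg_div, div_div, mul_comm (σ a - σ c)]

theorem dot_pol_pol {a b : Fin n} (ha : a ∈ E.neg) (hb : b ∈ E.neg) :
    dot (E.pol a) (E.pol b) = 0 := by
  rw [pol, pol, if_pos ha, if_pos hb, dot_smul_left, dot_smul_right, dot_vecMulVec]
  simp [sqb, mul_comm]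

/-- The coefficients of `|a⟩ξ_a` in terms of the momentum and the polarization of negative
helicity. -/
def bispinorCoeff (E : External n) {s : ℕ} (g : Fin s → Fin n) (ξ : Fin s → Spinor) :
    Fin s ⊕ Fin s → ℂ :=
  Sum.elim (fun b => sqb E.q (ξ b) / sqb E.q (E.lamt (g b))) fun b => sqb (E.lamt (g b)) (ξ b)

end External

/-! ### Null vectors of minors of Ψ and the helicity bounds -/

namespace IsCurve

variable {E : External n} {σ : Fin n → ℂ} {l m : Fin 2 → ℂ[X]} {t : Fin n → ℂ} {d e : ℕ}

/-- This row contracts k_a with the bispinors |b⟩ξ_b / σ_ab. By `hξ` the off-diagonal terms add up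
to the curvature times [ξ_a a], which the diagonal entry of `C` cancels. -/
theorem matPsi_mulVec_inl (h : IsCurve E σ l m t d e) (hE : E.Admissible) {s : ℕ}
    {g : Fin s → Fin n} (hg : Function.Injective g) {ξ : Fin s → Spinor}
    (hξ : ∀ a i, ∑ b ∈ univ.erase a,
      ang (E.lam (g a)) (E.lam (g b)) * ξ b i / (σ (g a) - σ (g b)) =
        curvature σ l t (g a) * ξ a i)
    (hpos : ∀ b, g b ∉ E.neg → sqb (E.lamt (g b)) (ξ b) = 0) (a : Fin s) :
    ((E.matPsi σ).submatrix (Sum.map g g) (Sum.map g g)).mulVec (E.bispinorCoeff g ξ)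
      (Sum.inl a) = 0 := by
  have hq : ∀ b, sqb E.q (E.lamt b) ≠ 0 := fun b => by
    rw [sqb_symm]; exact neg_ne_zero.2 (hE.sqb_ne_zero b)
  have hoff : ∀ b ∈ univ.erase a,
      E.matA σ (g a) (g b) * (sqb E.q (ξ b) / sqb E.q (E.lamt (g b))) -
        E.matC σ (g b) (g a) * sqb (E.lamt (g b)) (ξ b) =
      ang (E.lam (g a)) (E.lam (g b)) * ξ b 1 / (σ (g a) - σ (g b)) * E.lamt (g a) 0 -
      ang (E.lam (g a)) (E.lam (g b)) * ξ b 0 / (σ (g a) - σ (g b)) * E.lamt (g a) 1 := by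
    intro b hb
    have hgab : g a ≠ g b := hg.ne (Finset.ne_of_mem_erase hb).symm
    have hne : σ (g a) - σ (g b) ≠ 0 := sub_ne_zero.2 (h.inj.ne hgab)
    have hA : E.matA σ (g a) (g b) = ang (E.lam (g a)) (E.lam (g b)) *
        sqb (E.lamt (g b)) (E.lamt (g a)) / (σ (g a) - σ (g b)) := by
      rw [External.matA, Matrix.of_apply, if_neg hgab, External.mandelstam_eq]
    have hC : E.matC σ (g b) (g a) * sqb (E.lamt (g b)) (ξ b) =
        ang (E.lam (g a)) (E.lam (g b)) * sqb E.q (E.lamt (g a)) *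
          sqb (E.lamt (g b)) (ξ b) / (sqb E.q (E.lamt (g b)) * -(σ (g a) - σ (g b))) *
          -1 := by
      by_cases hb : g b ∈ E.neg
      · rw [External.matC_of_mem_neg hb hgab.symm, sqb_symm (E.lamt (g b)) E.q,
          sqb_symm (E.lamt (g a)) E.q, ← neg_sub (σ (g a))]
        have := hq (g b)
        field_simp
        simp only [ang]
        ring
      · rw [hpos b hb]
        simp
    rw [hA, hC]
    have hqb := hq (g b)
    field_simp
    simp only [sqb]
    ring
  -- At positive helicity C_aa need not be minus the curvature, but its coefficient vanishes.
  have hdiag : E.matC σ (g a) (g a) * sqb (E.lamt (g a)) (ξ a) =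
      -curvature σ l t (g a) * sqb (E.lamt (g a)) (ξ a) := by
    by_cases ha : g a ∈ E.neg
    · rw [External.matC_self_of_mem_neg ha, h.discMinus_diag hE]
    · simp [hpos a ha]
  have hA0 : E.matA σ (g a) (g a) = 0 := by simp [External.matA]
  simp only [Matrix.mulVec, dotProduct, Fintype.sum_sum_type, Matrix.submatrix_apply,
    Sum.map_inl, Sum.map_inr, External.matPsi, Matrix.fromBlocks_apply₁₁,
    Matrix.fromBlocks_apply₁₂, Matrix.neg_apply, Matrix.transpose_apply, External.bispinorCoeff,
    Sum.elim_inl, Sum.elim_inr, neg_mul]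
  rw [← Finset.sum_add_distrib, ← Finset.sum_erase_add _ _ (Finset.mem_univ a), hdiag, hA0]
  simp only [← sub_eq_add_neg]
  rw [Finset.sum_congr rfl hoff, Finset.sum_sub_distrib, ← Finset.sum_mul, ← Finset.sum_mul,
    hξ, hξ]
  simp only [sqb]
  ring

/-- The same contraction with ε_a(-), proportional to |a⟩|q]. The block `B` drops out, as
negative-helicity polarizations share |q] and are mutually orthogonal. -/
theorem matPsi_mulVec_inr (h : IsCurve E σ l m t d e) (hE : E.Admissible) {s : ℕ}
    {g : Fin s → Fin n} (hg : Function.Injective g) {ξ : Fin s → Spinor}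
    (hξ : ∀ a i, ∑ b ∈ univ.erase a,
      ang (E.lam (g a)) (E.lam (g b)) * ξ b i / (σ (g a) - σ (g b)) =
        curvature σ l t (g a) * ξ a i)
    (hpos : ∀ b, g b ∉ E.neg → sqb (E.lamt (g b)) (ξ b) = 0) {a : Fin s} (ha : g a ∈ E.neg) :
    ((E.matPsi σ).submatrix (Sum.map g g) (Sum.map g g)).mulVec (E.bispinorCoeff g ξ)
      (Sum.inr a) = 0 := by
  have hq : ∀ b, sqb E.q (E.lamt b) ≠ 0 := fun b => by
    rw [sqb_symm]; exact neg_ne_zero.2 (hE.sqb_ne_zero b)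
  have hqa := hE.sqb_ne_zero (g a)
  have hoff : ∀ b ∈ univ.erase a,
      E.matC σ (g a) (g b) * (sqb E.q (ξ b) / sqb E.q (E.lamt (g b))) +
        E.matB σ (g a) (g b) * sqb (E.lamt (g b)) (ξ b) =
      ang (E.lam (g a)) (E.lam (g b)) * ξ b 1 / (σ (g a) - σ (g b)) *
        (E.q 0 / sqb (E.lamt (g a)) E.q) -
      ang (E.lam (g a)) (E.lam (g b)) * ξ b 0 / (σ (g a) - σ (g b)) *
        (E.q 1 / sqb (E.lamt (g a)) E.q) := by
    intro b hb
    have hgab : g a ≠ g b := hg.ne (Finset.ne_of_mem_erase hb).symm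
    have hne : σ (g a) - σ (g b) ≠ 0 := sub_ne_zero.2 (h.inj.ne hgab)
    have hB : E.matB σ (g a) (g b) * sqb (E.lamt (g b)) (ξ b) = 0 := by
      by_cases hb : g b ∈ E.neg
      · rw [External.matB, Matrix.of_apply, if_neg hgab, External.dot_pol_pol ha hb]
        simp
      · rw [hpos b hb, mul_zero]
    rw [hB, External.matC_of_mem_neg ha hgab, sqb_symm (E.lamt (g b)) E.q, add_zero]
    have hqb := hq (g b)
    have h1 : ξ b 1 * E.q 0 - ξ b 0 * E.q 1 = -sqb E.q (ξ b) := by simp only [sqb]; ring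
    field_simp
    linear_combination (-ang (E.lam (g a)) (E.lam (g b))) * h1
  have hB0 : E.matB σ (g a) (g a) = 0 := by simp [External.matB]
  simp only [Matrix.mulVec, dotProduct, Fintype.sum_sum_type, Matrix.submatrix_apply,
    Sum.map_inl, Sum.map_inr, External.matPsi, Matrix.fromBlocks_apply₂₁,
    Matrix.fromBlocks_apply₂₂, External.bispinorCoeff, Sum.elim_inl, Sum.elim_inr]
  rw [← Finset.sum_add_distrib, ← Finset.sum_erase_add _ _ (Finset.mem_univ a), hB0,
    Finset.sum_congr rfl hoff, Finset.sum_sub_distrib, ← Finset.sum_mul, ← Finset.sum_mul,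
    hξ, hξ, External.matC_self_of_mem_neg ha, h.discMinus_diag hE, sqb_symm E.q (E.lamt (g a))]
  field_simp
  simp only [sqb]
  ring

theorem exists_submatrix_mulVec_eq_zero (h : IsCurve E σ l m t d e) (hE : E.Admissible)
    {s j : ℕ} {g : Fin s → Fin n} (hg : Function.Injective g) {κ : Fin j → Fin s}
    (hκ : Function.Injective κ)
    (hcard : 2 * d + (s - j) < 2 * (univ.filter fun i => g i ∈ E.neg).card) :
    ∃ v : Fin j ⊕ Fin s → ℂ, v ≠ 0 ∧
      ((E.matPsi σ).submatrix (Sum.map (g ∘ κ) g) (Sum.map (g ∘ κ) g)).mulVec v = 0 := by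
  let P := {i : Fin s // g i ∉ E.neg}
  let Q := {i : Fin s // i ∉ Set.range κ}
  let N := (E.matPsi σ).submatrix (Sum.map g g) (Sum.map g g)
  let ξ : (Fin 2 → degreeLT ℂ (s - d)) → Fin s → Spinor := fun τ b i =>
    (τ i).1.eval (σ (g b)) / (t (g b) * nodeProd (σ ∘ g) b)
  let V : (Fin 2 → degreeLT ℂ (s - d)) →ₗ[ℂ] (Fin s ⊕ Fin s → ℂ) :=
    { toFun := fun τ => E.bispinorCoeff g (ξ τ)
      map_add' := fun τ τ' => by
        ext (b | b) <;> simp [External.bispinorCoeff, ξ, sqb] <;> ring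
      map_smul' := fun c τ => by
        ext (b | b) <;> simp [External.bispinorCoeff, ξ, sqb] <;> ring }
  -- The obstructions: at each positive particle the ε-coefficient and the ε-row, and at each
  -- deleted index of `A` the momentum coefficient.
  let K : (Fin s ⊕ Fin s → ℂ) →ₗ[ℂ] ((P ⊕ P) ⊕ Q → ℂ) := LinearMap.pi (Sum.elim
    (Sum.elim (fun b => LinearMap.proj (Sum.inr b.1))
      (fun b => (LinearMap.proj (Sum.inr b.1)).comp N.mulVecLin))
    fun b => LinearMap.proj (Sum.inl b.1))
  have hP : (univ.filter fun i => g i ∈ E.neg).card + Fintype.card P = s := by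
    rw [Fintype.card_subtype, Finset.card_filter_add_card_filter_not, Finset.card_univ,
      Fintype.card_fin]
  have hQ : Fintype.card Q = s - j := by
    classical
    rw [Fintype.card_subtype_compl, Fintype.card_fin]
    congr 1
    exact (Set.card_range_of_injective hκ).trans (Fintype.card_fin j)
  have hlt : Module.finrank ℂ ((P ⊕ P) ⊕ Q → ℂ) <
      Module.finrank ℂ (Fin 2 → degreeLT ℂ (s - d)) := by
    rw [Module.finrank_fintype_fun_eq_card, Module.finrank_pi_fintype]
    simp only [(degreeLTEquiv ℂ (s - d)).finrank_eq, Module.finrank_fin_fun, Finset.sum_const,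
      Finset.card_univ, Fintype.card_fin, Fintype.card_sum, smul_eq_mul, hQ]
    omega
  have : FiniteDimensional ℂ (degreeLT ℂ (s - d)) :=
    Module.Finite.equiv (degreeLTEquiv ℂ (s - d)).symm
  obtain ⟨τ, hτ, hτ0⟩ := Submodule.exists_mem_ne_zero_of_ne_bot
    (LinearMap.ker_ne_bot_of_finrank_lt (f := K.comp V) hlt)
  have hKV : ∀ x, K (V τ) x = 0 := fun x => congrFun hτ x
  have hpos : ∀ b, g b ∉ E.neg → sqb (E.lamt (g b)) (ξ τ b) = 0 := fun b hb =>
    hKV (Sum.inl (Sum.inl ⟨b, hb⟩))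
  have hdel : ∀ b, b ∉ Set.range κ → V τ (Sum.inl b) = 0 := fun b hb =>
    hKV (Sum.inr ⟨b, hb⟩)
  have hξ : ∀ a i, ∑ b ∈ univ.erase a,
      ang (E.lam (g a)) (E.lam (g b)) * ξ τ b i / (σ (g a) - σ (g b)) =
        curvature σ l t (g a) * ξ τ a i := fun a i =>
    h.sum_ang_mul hg (mem_degreeLT.1 (τ i).2) a
  have hN : N.mulVec (V τ) = 0 := by
    funext x
    rcases x with a | a
    · exact h.matPsi_mulVec_inl hE hg hξ hpos a
    · by_cases ha : g a ∈ E.neg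
      · exact h.matPsi_mulVec_inr hE hg hξ hpos ha
      · exact hKV (Sum.inl (Sum.inr ⟨a, ha⟩))
  -- If the restricted vector is zero, every ξ_b vanishes because |b] and |q] span; then τ vanishes
  -- at s nodes, more than its degree allows.
  refine ⟨V τ ∘ Sum.map κ id, fun h0 => hτ0 ?_, ?_⟩
  · have hx : ∀ b, sqb E.q (ξ τ b) = 0 := by
      intro b
      have hb : V τ (Sum.inl b) = 0 := by
        by_cases hb : b ∈ Set.range κ
        · obtain ⟨c, rfl⟩ := hb
          exact congrFun h0 (Sum.inl c)
        · exact hdel b hb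
      refine (div_eq_zero_iff.1 hb).resolve_right ?_
      rw [sqb_symm]
      exact neg_ne_zero.2 (hE.sqb_ne_zero _)
    have hy : ∀ b, sqb (E.lamt (g b)) (ξ τ b) = 0 := fun b => congrFun h0 (Sum.inr b)
    have hξ0 : ∀ b i, ξ τ b i = 0 := by
      intro b i
      have hx := hx b
      have hy := hy b
      have hq := hE.sqb_ne_zero (g b)
      refine (mul_eq_zero.1 (?_ : sqb (E.lamt (g b)) E.q * ξ τ b i = 0)).resolve_left hq
      simp only [sqb] at hx hy ⊢
      fin_cases i
      · simp only [Fin.zero_eta]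
        linear_combination E.q 0 * hy - E.lamt (g b) 0 * hx
      · simp only [Fin.mk_one]
        linear_combination E.q 1 * hy - E.lamt (g b) 1 * hx
    funext i
    refine Subtype.ext (eq_zero_of_degree_lt_of_eval_index_eq_zero univ
      (h.inj.comp hg).injOn ?_ fun b _ => ?_)
    · rw [Finset.card_univ, Fintype.card_fin]
      exact (mem_degreeLT.1 (τ i).2).trans_le (by exact_mod_cast Nat.sub_le s d)
    · exact (div_eq_zero_iff.1 (hξ0 b i)).resolve_right
        (mul_ne_zero (h.t_ne _) (nodeProd_ne_zero (h.inj.comp hg) b))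
  · funext x
    refine Eq.trans ?_ (congrFun hN (Sum.map κ id x))
    simp only [Matrix.mulVec, dotProduct, Fintype.sum_sum_type, N]
    congr 1
    · refine (Fintype.sum_of_injective κ hκ _ _ (fun b hb => ?_) fun b => ?_)
      · rw [hdel b hb, mul_zero]
      · rcases x with x | x <;> rfl
    · refine Finset.sum_congr rfl fun b _ => ?_
      rcases x with x | x <;> rfl

/-- The helicity bound on a minor of `Ψ` with `s - j` rows and columns of `A` deleted. -/
theorem card_neg_le (h : IsCurve E σ l m t d e) (hE : E.Admissible)
    {s j : ℕ} {g : Fin s → Fin n} (hg : Function.Injective g) {κ : Fin j → Fin s}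
    (hκ : Function.Injective κ)
    (hPf : pfaffianSum ((E.matPsi σ).submatrix (Sum.map (g ∘ κ) g) (Sum.map (g ∘ κ) g)) ≠ 0) :
    2 * (univ.filter fun i => g i ∈ E.neg).card ≤ 2 * d + (s - j) := by
  by_contra! hcard
  obtain ⟨v, hv, hv0⟩ := h.exists_submatrix_mulVec_eq_zero hE hg hκ hcard
  exact hPf (pfaffianSum_eq_zero (fun a b => E.matPsi_antisymm σ _ _) hv hv0)

theorem card_pos_le (h : IsCurve E σ l m t d e) (hE : E.Admissible)
    {s j : ℕ} {g : Fin s → Fin n} (hg : Function.Injective g) {κ : Fin j → Fin s}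
    (hκ : Function.Injective κ)
    (hPf : pfaffianSum ((E.matPsi σ).submatrix (Sum.map (g ∘ κ) g) (Sum.map (g ∘ κ) g)) ≠ 0) :
    2 * (univ.filter fun i => g i ∉ E.neg).card ≤ 2 * e + (s - j) := by
  by_contra! hcard
  obtain ⟨v, hv, hv0⟩ := h.swap.exists_submatrix_mulVec_eq_zero hE.swap hg hκ
    (by simpa [External.swap] using hcard)
  -- Conjugation by these signs carries a null vector of the parity conjugate back to Ψ.
  let ε : Fin j ⊕ Fin s → ℂ := Sum.elim (fun _ => 1) fun _ => -1
  have hε : ∀ x, ε x * ε x = 1 := by rintro (x | x) <;> simp [ε]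
  have hεs : ∀ x, External.paritySign (Sum.map (g ∘ κ) g x) = ε x := by
    rintro (x | x) <;> rfl
  refine hPf (pfaffianSum_eq_zero (fun a b => E.matPsi_antisymm σ _ _)
    (v := fun x => ε x * v x) (fun h0 => hv ?_) ?_)
  · funext x
    have := congrFun h0 x
    simp only [Pi.zero_apply] at this ⊢
    linear_combination ε x * this - v x * hε x
  · funext x
    have := congrFun hv0 x
    simp only [Matrix.mulVec, dotProduct, Matrix.submatrix_apply, External.swap_matPsi, hεs,
      Pi.zero_apply] at this ⊢
    have h2 := congrArg (ε x * ·) this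
    simp only [mul_zero, Finset.mul_sum] at h2
    rw [← h2]
    refine Finset.sum_congr rfl fun y _ => ?_
    linear_combination (-E.matPsi σ (Sum.map (g ∘ κ) g x) (Sum.map (g ∘ κ) g y) * ε y * v y) * hε x

end IsCurve

end CHY

end

/-! ### Support and helicity range -/

theorem mainTheorem3 {n s r : ℕ} (hn : 4 ≤ n) (L : CHY.Labelling s r n)
    (E : CHY.External n) (hE : E.Admissible) :
    ({σ | σ ∈ E.solutions ∧ L.pfH E σ ≠ 0} ⊆
        ⋃ m ∈ Set.Icc ((L.sMinus E : ℤ) - 1) ((n : ℤ) - 3 - L.sPlus E), E.PMinus m) ∧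
      ∀ k : ℤ, (E.neg.card : ℤ) = k + 2 → 2 ≤ r →
        ((∃ σ ∈ E.solutions, L.integrand hn E σ ≠ 0) ∨ L.amplitude hn E ≠ 0) →
          max 0 ((L.sMinus E : ℤ) - 1) ≤ k ∧
            k ≤ min ((n : ℤ) - 4) ((n : ℤ) - 3 - L.sPlus E) := by
  have hL : Function.Injective L.graviton := L.injective.comp Sum.inl_injective
  have hbound : ∀ σ ∈ E.solutions, L.pfH E σ ≠ 0 → ∃ (l m : Fin 2 → Polynomial ℂ)
      (t : Fin n → ℂ) (d e : ℕ), CHY.IsCurve E σ l m t d e ∧ (E.discMinus σ).rank = d ∧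
        1 ≤ d ∧ 1 ≤ e ∧ L.sMinus E ≤ d ∧ L.sPlus E ≤ e := by
    intro σ hσ hPf
    obtain ⟨l, m, t, d, e, h, hcop, hd⟩ := CHY.External.exists_isCurve hn hE hσ
    refine ⟨l, m, t, d, e, h, h.rank_discMinus hE hcop hd, h.one_le_deg hn hE,
      h.swap.one_le_deg hn hE.swap, ?_, ?_⟩
    · have := h.card_neg_le hE hL (κ := id) Function.injective_id hPf
      simp only [CHY.Labelling.sMinus]
      omega
    · have := h.card_pos_le hE hL (κ := id) Function.injective_id hPf
      simp only [CHY.Labelling.sPlus]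
      omega
  refine ⟨?_, fun k hk _ hI => ?_⟩
  · rintro σ ⟨hσ, hPf⟩
    obtain ⟨l, m, t, d, e, h, hrank, hd, he, hneg, hpos⟩ := hbound σ hσ hPf
    have hadd := h.deg_add
    simp only [Set.mem_iUnion]
    -- The rank m + 1 equals d; the upper bounds on m use d + e ≤ n - 2 together with s⁺ ≤ e and 1 ≤
    -- e.
    refine ⟨(d : ℤ) - 1, ⟨by omega, by omega⟩, hσ, by omega, by omega, by omega⟩
  · obtain ⟨σ, hσ, hIσ⟩ : ∃ σ ∈ E.solutions, L.integrand hn E σ ≠ 0 := by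
      refine hI.elim id fun hA => ?_
      by_contra! h0
      refine hA (finsum_eq_zero_of_forall_eq_zero fun c => ?_)
      rw [h0 _ c.out.2, zero_div]
    have hne := left_ne_zero_of_mul (div_ne_zero_iff.1 hIσ).1
    have hred := right_ne_zero_of_mul (div_ne_zero_iff.1 hIσ).1
    obtain ⟨l, m, t, d, e, h, hrank, hd, he, hneg, hpos⟩ :=
      hbound σ hσ (right_ne_zero_of_mul hne)
    have hPf := right_ne_zero_of_mul hred
    have hκ : Function.Injective (Fin.castLE (Nat.sub_le n 2)) := Fin.castLE_injective _
    -- With two deleted indices the bounds read k + 2 ≤ d + 1 and n - k - 2 ≤ e + 1. Against d + e ≤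
    -- n - 2 both are equalities, and the bounds on d and e become bounds on k.
    have h1 := h.card_neg_le hE (g := id) Function.injective_id hκ hPf
    have h2 := h.card_pos_le hE (g := id) Function.injective_id hκ hPf
    have h3 := Finset.card_filter_add_card_filter_not (s := Finset.univ)
      (fun i : Fin n => i ∈ E.neg)
    have h4 : (Finset.univ.filter fun i : Fin n => i ∈ E.neg) = E.neg := by simp
    simp only [id, Finset.card_univ, Fintype.card_fin] at h1 h2 h3
    rw [h4] at h1 h3
    have hadd := h.deg_add
    simp only [max_le_iff, le_min_iff]
    omega
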